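/- **Setting.** Let $x_L<x_R$ and $\Omega=[x_L,x_R]$. Let $\sigma_T,\sigma_S$ be measurable functions on $\Omega$ such that $\sigma_T$ is essentially bounded and essentially bounded below by a positive constant, $\sigma_S\ge 0$ a.e., and $\lambda:=\|\sigma_S/\sigma_T\|_{L^\infty(\Omega)}\in(0,1)$; put $\sigma_r:=\sigma_S/\lambda$. Let $L^2(\Omega;\sigma_T)$ be the real $L^2$ space with inner product $\langle f,g\rangle=\int_{x_L}^{x_R} fg\,\sigma_T\,dx$, and let $\|\cdot\|$ denote the operator norm on it. For $\mu\neq 0$ let $\mathcal A_\mu$ be the bounded operator on $L^2(\Omega;\sigma_T)$ that maps $\phi$ to the solution $\psi$ of $\mu\,\partial_x\psi+\sigma_T\psi=\sigma_r\phi$ with zero inflow data ($\psi(x_L)=0$ if $\mu>0$, $\psi(x_R)=0$ if $\mu<0$), that is, $$ \mathcal A_\mu\phi(x)=\begin{cases}\dfrac1\mu\displaystyle\int_{x_L}^{x}e^{-\frac1\mu\int_y^x\sigma_T(z)\,dz}\,\sigma_r(y)\phi(y)\,dy,&\mu>0,\\[2mm] -\dfrac1\mu\displaystyle\int_{x}^{x_R}e^{\frac1\mu\int_x^y\sigma_T(z)\,dz}\,\sigma_r(y)\phi(y)\,dy,&\mu<0.\end{cases}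 $$ Let $0<\delta<1$, $S=[-1,-\delta)\cup(\delta,1]$ (the truncated velocity space), and let $\mathcal T=\frac1{|S|}\int_S\mathcal A_\mu\,d\mu$ be the iteration operator of the truncated system. **Random ordinates.** Let $n=2m$ with $m\ge1$. Given nodes $-1=a_0<a_1<\dots<a_m=-\delta$, let $S_\ell=[a_{\ell-1},a_\ell)$ and $S_{n+1-\ell}=-S_\ell$ for $1\le\ell\le m$, and let $\omega_\ell=|S_\ell|/|S|$ and $\alpha_\ell=n\,\omega_\ell$ for $1\le\ell\le n$. Let $\mu_1,\dots,\mu_m$ be independent random variables, $\mu_\ell$ uniformly distributed on $S_\ell$, let $\mu_{n+1-\ell}=-\mu_\ell$ for $1\le\ell\le m$, and put $$ \mathcal T^\xi=\frac1n\sum_{\ell=1}^n\alpha_\ell\,\mathcal A_{\mu_\ell},\qquad \delta\mathcal T^\xi=\mathcal T^\xi-\mathcal T . $$ **Claim.** The map $\mu\mapsto\mathcal A_\mu$ is Bochner integrable on $S$ in the operator norm. Moreover, for every $K$ there is a constant $C$, depending only on $K$, $\delta$, $\Omega$, $\sigma_T$ and $\sigma_S$, such that for every even $n=2m\ge2$ and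 all nodes as above with $\alpha_\ell\le K$ for $\ell=1,\dots,n$, the random variable $\|\delta\mathcal T^\xi\|^2$ is integrable and $$ \mathbb E\,\|\delta\mathcal T^\xi\|^2\le C\,(\log n+1)\,n^{-3}. $$ In particular, $C$ does not depend on $n$. -/

import Mathlib

open MeasureTheory ProbabilityTheory Set

noncomputable section

/-- The data of the steady radiative transport problem in slab geometry `[xL, xR]` with isotropic
scattering: total and scattering cross sections `σT`, `σS`, where `σT` is essentially bounded and
bounded away from zero, `σS` is nonnegative, and `λ = ‖σS / σT‖_∞` lies in `(0, 1)`. -/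
structure SlabMedium where
  xL : ℝ
  xR : ℝ
  σT : ℝ → ℝ
  σS : ℝ → ℝ
  xL_lt_xR : xL < xR
  σT_memLp : MemLp σT ⊤ (volume.restrict (Icc xL xR))
  σT_lower : ∃ c : ℝ, 0 < c ∧ ∀ᵐ x ∂(volume.restrict (Icc xL xR)), c ≤ σT x
  σS_meas : AEStronglyMeasurable σS (volume.restrict (Icc xL xR))
  σS_nonneg : ∀ᵐ x ∂(volume.restrict (Icc xL xR)), 0 ≤ σS x
  ratio_pos : 0 < eLpNorm (fun x => σS x / σT x) ⊤ (volume.restrict (Icc xL xR))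
  ratio_lt_one : eLpNorm (fun x => σS x / σT x) ⊤ (volume.restrict (Icc xL xR)) < 1

namespace SlabMedium

variable (M : SlabMedium)

/-- `λ = ‖σS / σT‖_∞`. -/
def lam : ℝ := (eLpNorm (fun x => M.σS x / M.σT x) ⊤ (volume.restrict (Icc M.xL M.xR))).toReal

/-- `σr = σS / λ`. -/
def σr (x : ℝ) : ℝ := M.σS x / M.lam

/-- The measure `σT dx` on `[xL, xR]`. -/
def weight : Measure ℝ :=
  (volume.restrict (Icc M.xL M.xR)).withDensity (fun x => ENNReal.ofReal (M.σT x))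

/-- The space `L²([xL, xR]; σT)`. -/
abbrev L2 : Type := Lp ℝ 2 M.weight

/-- The kernel `k_μ(x, y)` of the solution operator `φ ↦ ψ` of
`μ ∂ₓψ + σT ψ = σr φ` with zero inflow, with respect to the measure `σT dy`. -/
def kernel (μ x y : ℝ) : ℝ :=
  if 0 < μ then
    if y ≤ x then
      1 / μ * Real.exp (-(1 / μ) * ∫ z in y..x, M.σT z) * (M.σr y / M.σT y)
    else 0
  else if μ < 0 then
    if x ≤ y then
      -(1 / μ) * Real.exp (1 / μ * ∫ z in x..y, M.σT z) * (M.σr y / M.σT y)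
    else 0
  else 0

lemma weight_ac : M.weight ≪ volume.restrict (Icc M.xL M.xR) :=
  withDensity_absolutelyContinuous _ _

lemma integrableOn_σT : IntegrableOn M.σT (Icc M.xL M.xR) :=
  M.σT_memLp.integrable le_top

instance : IsFiniteMeasure M.weight :=
  isFiniteMeasure_withDensity_ofReal M.integrableOn_σT.2

lemma lam_pos : 0 < M.lam :=
  ENNReal.toReal_pos M.ratio_pos.ne' (M.ratio_lt_one.trans ENNReal.one_lt_top).ne

lemma ratio_bound : ∀ᵐ y ∂(volume.restrict (Icc M.xL M.xR)), |M.σr y / M.σT y| ≤ 1 := by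
  have h := ae_le_eLpNormEssSup (f := fun x => M.σS x / M.σT x)
    (μ := volume.restrict (Icc M.xL M.xR))
  filter_upwards [h] with y hy
  rw [← eLpNorm_exponent_top] at hy
  have h2 := ENNReal.toReal_mono (M.ratio_lt_one.trans ENNReal.one_lt_top).ne hy
  rw [toReal_enorm, Real.norm_eq_abs] at h2
  have e : M.σr y / M.σT y = (M.σS y / M.σT y) / M.lam := by
    unfold σr; ring
  rw [e, abs_div, abs_of_pos M.lam_pos, div_le_one M.lam_pos]
  exact h2

lemma integral_σT_nonneg {a b : ℝ} (ha : M.xL ≤ a) (hab : a ≤ b) (hb : b ≤ M.xR) :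
    0 ≤ ∫ z in a..b, M.σT z := by
  obtain ⟨c, hc, h⟩ := M.σT_lower
  refine intervalIntegral.integral_nonneg_of_ae_restrict hab ?_
  have h2 := ae_restrict_of_ae_restrict_of_subset (Icc_subset_Icc ha hb) h
  filter_upwards [h2] with x hx
  exact hc.le.trans hx

lemma kernel_bound (μ : ℝ) {x : ℝ} (hx : x ∈ Icc M.xL M.xR) :
    ∀ᵐ y ∂M.weight, ‖M.kernel μ x y‖ ≤ |μ|⁻¹ := by
  refine M.weight_ac.ae_le ?_
  filter_upwards [M.ratio_bound, ae_restrict_mem measurableSet_Icc] with y hy hyI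
  have key : ∀ e r : ℝ, e ≤ 0 → |r| ≤ 1 → ∀ c : ℝ, |c * Real.exp e * r| ≤ |c| := by
    intro e r he hr c
    rw [abs_mul, abs_mul, Real.abs_exp, mul_assoc]
    have : Real.exp e * |r| ≤ 1 :=
      mul_le_one₀ (Real.exp_le_one_iff.2 he) (abs_nonneg _) hr
    nlinarith [abs_nonneg c]
  have h0 : (0 : ℝ) ≤ |μ|⁻¹ := by positivity
  rw [Real.norm_eq_abs]
  unfold kernel
  split_ifs with h1 h2 h3 h4
  · refine (key _ _ ?_ hy _).trans (by rw [one_div, abs_inv])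
    have := M.integral_σT_nonneg hyI.1 h2 hx.2
    have h5 : 0 < 1 / μ := by positivity
    nlinarith
  · simp
  · refine (key _ _ ?_ hy _).trans (by rw [one_div, abs_neg, abs_inv])
    have := M.integral_σT_nonneg hx.1 h4 hyI.2
    have h5 : 1 / μ < 0 := one_div_neg.2 h3
    nlinarith
  · simp
  · simp

lemma kernel_meas (μ : ℝ) :
    AEStronglyMeasurable (fun p : ℝ × ℝ => M.kernel μ p.1 p.2) (M.weight.prod M.weight) := by
  set F : ℝ → ℝ := fun t => ∫ z in M.xL..t, M.σT z with hF
  have hii : ∀ a ∈ Icc M.xL M.xR, ∀ b ∈ Icc M.xL M.xR, IntervalIntegrable M.σT volume a b := by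
    intro a ha b hb
    refine IntegrableOn.intervalIntegrable (M.integrableOn_σT.mono_set ?_)
    exact uIcc_subset_Icc ha hb
  have hFm : AEMeasurable F M.weight := by
    have : ContinuousOn F (Icc M.xL M.xR) := by
      have := intervalIntegral.continuousOn_primitive_interval (f := M.σT) (μ := volume)
        (a := M.xL) (b := M.xR) (by rw [uIcc_of_le M.xL_lt_xR.le]; exact M.integrableOn_σT)
      rwa [uIcc_of_le M.xL_lt_xR.le] at this
    exact (this.aemeasurable measurableSet_Icc).mono_ac M.weight_ac
  have hsub : ∀ a ∈ Icc M.xL M.xR, ∀ b ∈ Icc M.xL M.xR,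
      ∫ z in a..b, M.σT z = F b - F a := by
    intro a ha b hb
    have hL : M.xL ∈ Icc M.xL M.xR := left_mem_Icc.2 M.xL_lt_xR.le
    rw [hF, intervalIntegral.integral_interval_sub_left (hii _ hL _ hb) (hii _ hL _ ha)]
  have hr : AEMeasurable (fun y => M.σr y / M.σT y) M.weight := by
    refine AEMeasurable.mono_ac ?_ M.weight_ac
    exact (M.σS_meas.aemeasurable.div_const _).div M.σT_memLp.1.aemeasurable
  have hF1 : AEMeasurable (fun p : ℝ × ℝ => F p.1) (M.weight.prod M.weight) :=
    hFm.comp_quasiMeasurePreserving Measure.quasiMeasurePreserving_fst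
  have hF2 : AEMeasurable (fun p : ℝ × ℝ => F p.2) (M.weight.prod M.weight) :=
    hFm.comp_quasiMeasurePreserving Measure.quasiMeasurePreserving_snd
  have hr2 : AEMeasurable (fun p : ℝ × ℝ => M.σr p.2 / M.σT p.2) (M.weight.prod M.weight) :=
    hr.comp_quasiMeasurePreserving Measure.quasiMeasurePreserving_snd
  have hI : ∀ᵐ x ∂M.weight, x ∈ Icc M.xL M.xR :=
    M.weight_ac.ae_le (ae_restrict_mem measurableSet_Icc)
  have hI1 : ∀ᵐ p ∂(M.weight.prod M.weight), p.1 ∈ Icc M.xL M.xR :=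
    Measure.quasiMeasurePreserving_fst.ae hI
  have hI2 : ∀ᵐ p ∂(M.weight.prod M.weight), p.2 ∈ Icc M.xL M.xR :=
    Measure.quasiMeasurePreserving_snd.ae hI
  refine AEMeasurable.aestronglyMeasurable ?_
  rcases lt_trichotomy μ 0 with h | h | h
  · have hm : AEMeasurable ({p : ℝ × ℝ | p.1 ≤ p.2}.indicator
        (fun p => -(1 / μ) * Real.exp (1 / μ * (F p.2 - F p.1)) * (M.σr p.2 / M.σT p.2)))
        (M.weight.prod M.weight) := by
      refine AEMeasurable.indicator ?_ (measurableSet_le measurable_fst measurable_snd)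
      exact ((Real.measurable_exp.comp_aemeasurable
        ((hF2.sub hF1).const_mul _)).const_mul _).mul hr2
    refine hm.congr ?_
    filter_upwards [hI1, hI2] with p h1 h2
    by_cases hp : p.1 ≤ p.2
    · simp [kernel, h, h.not_gt, hp, hsub _ h1 _ h2]
    · simp [kernel, h, h.not_gt, hp]
  · subst h
    simp [kernel]
  · have hm : AEMeasurable ({p : ℝ × ℝ | p.2 ≤ p.1}.indicator
        (fun p => 1 / μ * Real.exp (-(1 / μ) * (F p.1 - F p.2)) * (M.σr p.2 / M.σT p.2)))
        (M.weight.prod M.weight) := by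
      refine AEMeasurable.indicator ?_ (measurableSet_le measurable_snd measurable_fst)
      exact ((Real.measurable_exp.comp_aemeasurable
        ((hF1.sub hF2).const_mul _)).const_mul _).mul hr2
    refine hm.congr ?_
    filter_upwards [hI1, hI2] with p h1 h2
    by_cases hp : p.2 ≤ p.1
    · simp [kernel, h, hp, hsub _ h2 _ h1]
    · simp [kernel, h, hp]

lemma kernel_meas_right (μ : ℝ) :
    ∀ᵐ x ∂M.weight, AEStronglyMeasurable (fun y => M.kernel μ x y) M.weight :=
  (M.kernel_meas μ).prodMk_left

lemma L2_integrable (φ : M.L2) : Integrable φ M.weight :=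
  (Lp.memLp φ).integrable (by norm_num)

lemma kernel_integrable (μ : ℝ) (φ : M.L2) :
    ∀ᵐ x ∂M.weight, Integrable (fun y => M.kernel μ x y * φ y) M.weight := by
  have hI : ∀ᵐ x ∂M.weight, x ∈ Icc M.xL M.xR :=
    M.weight_ac.ae_le (ae_restrict_mem measurableSet_Icc)
  filter_upwards [M.kernel_meas_right μ, hI] with x h1 h2
  exact (M.L2_integrable φ).bdd_mul h1 (M.kernel_bound μ h2)

lemma kernel_integral_bound (μ : ℝ) (φ : M.L2) :
    ∀ᵐ x ∂M.weight, ‖∫ y, M.kernel μ x y * φ y ∂M.weight‖ ≤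
      |μ|⁻¹ * ∫ y, ‖φ y‖ ∂M.weight := by
  have hI : ∀ᵐ x ∂M.weight, x ∈ Icc M.xL M.xR :=
    M.weight_ac.ae_le (ae_restrict_mem measurableSet_Icc)
  filter_upwards [hI] with x hx
  rw [← integral_const_mul]
  refine norm_integral_le_of_norm_le ((M.L2_integrable φ).norm.const_mul _) ?_
  filter_upwards [M.kernel_bound μ hx] with y hy
  rw [norm_mul]
  gcongr

lemma kernel_integral_memLp (μ : ℝ) (φ : M.L2) :
    MemLp (fun x => ∫ y, M.kernel μ x y * φ y ∂M.weight) 2 M.weight := by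
  refine MemLp.of_bound ?_ _ (M.kernel_integral_bound μ φ)
  have h := (M.kernel_meas μ).mul
    ((Lp.aestronglyMeasurable φ).comp_quasiMeasurePreserving
      (Measure.quasiMeasurePreserving_snd (μ := M.weight) (ν := M.weight)))
  exact h.integral_prod_right'

/-- The integral operator with kernel `k_μ`, as a linear map. -/
def transportLin (μ : ℝ) : M.L2 →ₗ[ℝ] M.L2 where
  toFun φ := (M.kernel_integral_memLp μ φ).toLp
  map_add' φ χ := by
    rw [← MemLp.toLp_add]
    refine MemLp.toLp_congr _ _ ?_
    filter_upwards [M.kernel_integrable μ φ, M.kernel_integrable μ χ] with x h1 h2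
    rw [Pi.add_apply, ← integral_add h1 h2]
    refine integral_congr_ae ?_
    filter_upwards [Lp.coeFn_add φ χ] with y hy
    rw [hy, Pi.add_apply, mul_add]
  map_smul' c φ := by
    rw [RingHom.id_apply, ← MemLp.toLp_const_smul]
    refine MemLp.toLp_congr _ _ (Filter.Eventually.of_forall fun x => ?_)
    simp only [Pi.smul_apply, smul_eq_mul]
    rw [← integral_const_mul]
    refine integral_congr_ae ?_
    filter_upwards [Lp.coeFn_smul c φ] with y hy
    rw [hy, Pi.smul_apply, smul_eq_mul]
    ring

lemma transportLin_bound (μ : ℝ) :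
    ∃ C : ℝ, ∀ φ : M.L2, ‖M.transportLin μ φ‖ ≤ C * ‖φ‖ := by
  set V : ℝ := M.weight.real univ ^ (1 / 2 : ℝ) with hV
  refine ⟨V * (|μ|⁻¹ * V), fun φ => ?_⟩
  have h1 : ∫ y, ‖φ y‖ ∂M.weight ≤ V * ‖φ‖ := by
    have h := eLpNorm_le_eLpNorm_mul_rpow_measure_univ (p := 1) (q := 2) (by norm_num)
      (Lp.aestronglyMeasurable φ)
    have h2 := ENNReal.toReal_mono (ENNReal.mul_ne_top (Lp.eLpNorm_ne_top φ)
      (ENNReal.rpow_ne_top_of_nonneg (by norm_num) (measure_ne_top M.weight univ))) h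
    rw [integral_norm_eq_lintegral_enorm (Lp.aestronglyMeasurable φ), ← eLpNorm_one_eq_lintegral_enorm]
    refine h2.trans (le_of_eq ?_)
    rw [ENNReal.toReal_mul, ← Lp.norm_def, ← ENNReal.toReal_rpow, mul_comm, hV]
    norm_num [Measure.real]
  have h3 : ∀ᵐ x ∂M.weight, ‖M.transportLin μ φ x‖ ≤ |μ|⁻¹ * ∫ y, ‖φ y‖ ∂M.weight := by
    filter_upwards [M.kernel_integral_bound μ φ,
      (M.kernel_integral_memLp μ φ).coeFn_toLp] with x h4 h5
    change ‖(MemLp.toLp _ (M.kernel_integral_memLp μ φ) : M.L2) x‖ ≤ _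
    rw [h5]
    exact h4
  have h6 := Lp.norm_le_of_ae_bound (by positivity) h3
  refine h6.trans ?_
  have h7 : (measureUnivNNReal M.weight : ℝ) ^ (ENNReal.toReal 2)⁻¹ = V := by
    rw [hV]; norm_num [Measure.real, measureUnivNNReal]
    rfl
  rw [h7, mul_assoc, mul_assoc]
  have hV0 : 0 ≤ V := by positivity
  gcongr

/-- The operator `𝒜_μ` on `L²([xL, xR]; σT)`. -/
def transportOp (μ : ℝ) : M.L2 →L[ℝ] M.L2 where
  toLinearMap := M.transportLin μ
  cont := by
    obtain ⟨C, hC⟩ := M.transportLin_bound μ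
    exact AddMonoidHomClass.continuous_of_bound (M.transportLin μ) C hC

/-- `𝒜_μ φ (x) = ∫ k_μ(x, y) φ(y) σT(y) dy`. -/
lemma transportOp_apply_ae (μ : ℝ) (φ : M.L2) :
    M.transportOp μ φ =ᵐ[M.weight] fun x => ∫ y, M.kernel μ x y * φ y ∂M.weight :=
  MemLp.coeFn_toLp (M.kernel_integral_memLp μ φ)

end SlabMedium

/-- The truncated velocity space `S^δ = [-1, -δ) ∪ (δ, 1]`. -/
def truncVelocity (δ : ℝ) : Set ℝ := Ico (-1) (-δ) ∪ Ioc δ 1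

/-- The iteration operator `𝒯` of the truncated system: the average of `𝒜_μ` over `S^δ`. -/
def SlabMedium.iterOp (M : SlabMedium) (δ : ℝ) : M.L2 →L[ℝ] M.L2 :=
  ⨍ μ in truncVelocity δ, M.transportOp μ

/-- A division of `[-1, -δ)` into `m` subintervals `[a_ℓ, a_{ℓ+1})`,
where `-1 = a_0 < a_1 < ⋯ < a_m = -δ`. -/
structure VelocityMesh (δ : ℝ) (m : ℕ) where
  node : Fin (m + 1) → ℝ
  strictMono : StrictMono node
  node_zero : node 0 = -1
  node_last : node (Fin.last m) = -δ

namespace VelocityMesh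

variable {δ : ℝ} {m : ℕ} (G : VelocityMesh δ m)

/-- The `ℓ`-th cell of `[-1, -δ)`. -/
def halfCell (ℓ : Fin m) : Set ℝ := Ico (G.node ℓ.castSucc) (G.node ℓ.succ)

/-- All `n = m + m` cells of `S^δ`: first the cells of `[-1, -δ)`, then their reflections in
reversed order, which divide `(δ, 1]`. -/
def cell : Fin (m + m) → Set ℝ :=
  Fin.append G.halfCell
    (fun j => Ioc (-G.node j.rev.succ) (-G.node j.rev.castSucc))

/-- The weights `ω_ℓ = |S_ℓ| / |S^δ|`. -/
def weight (ℓ : Fin (m + m)) : ℝ := volume.real (G.cell ℓ) / volume.real (truncVelocity δ)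

/-- The rescaled weights `α_ℓ = n ω_ℓ`. -/
def rescaledWeight (ℓ : Fin (m + m)) : ℝ := ((m + m : ℕ) : ℝ) * G.weight ℓ

end VelocityMesh

/-- Symmetric ordinates: `u` on the cells of the left half, and
`μ_{m+ℓ} = -μ_{m+1-ℓ}` (with `ℓ = 1, …, m`) on the right half. -/
def symmOrdinates {m : ℕ} (u : Fin m → ℝ) : Fin (m + m) → ℝ :=
  Fin.append u (fun j => -u j.rev)

/-- The iteration operator `𝒯^ξ = (1/n) ∑_ℓ α_ℓ 𝒜_{μ_ℓ}` of the random ordinate method. -/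
def SlabMedium.romOp (M : SlabMedium) {δ : ℝ} {m : ℕ} (G : VelocityMesh δ m) (u : Fin m → ℝ) :
    M.L2 →L[ℝ] M.L2 :=
  (1 / ((m + m : ℕ) : ℝ)) •
    ∑ ℓ : Fin (m + m), G.rescaledWeight ℓ • M.transportOp (symmOrdinates u ℓ)

/-- Random ordinates: `μ_1, …, μ_m` are independent, `μ_ℓ` uniformly distributed on the
`ℓ`-th cell. -/
structure IsRandomOrdinates {δ : ℝ} {m : ℕ} (G : VelocityMesh δ m) {Ω : Type*}
    [MeasurableSpace Ω] (P : Measure Ω) (X : Fin m → Ω → ℝ) : Prop where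
  measurable : ∀ ℓ, Measurable (X ℓ)
  indep : iIndepFun X P
  uniform : ∀ ℓ, pdf.IsUniform (X ℓ) (G.halfCell ℓ) P volume

end

/-! Each `𝒜_μ` is an integral operator whose kernel is bounded on a finite measure space, hence
Hilbert–Schmidt, and the operator norm is at most the `L²` norm of the kernel
(`HasKernel.opNorm_le`). This moves the error from the space of operators, where variances do not
add, to a Hilbert space, where they do.

Pairing every cell with its reflection writes the kernel of `𝒯^ξ - 𝒯` as a sum over the left cells,
one function of `μ_ℓ` each (`hasKernel_romOp_sub_iterOp`). The summands are independent, and centred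
because `μ_ℓ` is uniform on its cell, so the mean square of the sum is the sum of the mean squares
(`integral_norm_sum_sq_of_iIndepFun`).

In `L²` the kernel is Lipschitz in `1/μ` (`exists_norm_kernelL2_sub_le`), hence in `μ` for `|μ| ≥
δ`. A summand is at most weight times cell width times a constant, which is `O(n⁻²)`; `m` squares of
this size give `O(n⁻³)`. The logarithm in the claim is not needed. -/

/-! ### Hilbert–Schmidt operators in weak form -/

section HilbertSchmidt

variable {α : Type*} [MeasurableSpace α] {ν : Measure α}

theorem norm_sq_eq_integral_sq (f : Lp ℝ 2 ν) : ‖f‖ ^ 2 = ∫ x, f x ^ 2 ∂ν := by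
  rw [← real_inner_self_eq_norm_sq, L2.inner_def]
  refine integral_congr_ae (Filter.Eventually.of_forall fun x => ?_)
  simp [sq]

theorem memLp_two_tensor (ψ φ : Lp ℝ 2 ν) :
    MemLp (fun p : α × α => ψ p.1 * φ p.2) 2 (ν.prod ν) := by
  have hm : AEStronglyMeasurable (fun p : α × α => ψ p.1 * φ p.2) (ν.prod ν) :=
    ((Lp.aestronglyMeasurable ψ).comp_quasiMeasurePreserving
      Measure.quasiMeasurePreserving_fst).mul
    ((Lp.aestronglyMeasurable φ).comp_quasiMeasurePreserving
      Measure.quasiMeasurePreserving_snd)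
  rw [memLp_two_iff_integrable_sq hm]
  refine ((Lp.memLp ψ).integrable_sq.mul_prod (Lp.memLp φ).integrable_sq).congr ?_
  exact Filter.Eventually.of_forall fun p => by simp only; ring

/-- The function `(x, y) ↦ ψ x * φ y` as an element of `L²(ν × ν)`. -/
noncomputable def tensorL2 (ψ φ : Lp ℝ 2 ν) : Lp ℝ 2 (ν.prod ν) :=
  (memLp_two_tensor ψ φ).toLp

theorem coeFn_tensorL2 (ψ φ : Lp ℝ 2 ν) :
    tensorL2 ψ φ =ᵐ[ν.prod ν] fun p => ψ p.1 * φ p.2 :=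
  (memLp_two_tensor ψ φ).coeFn_toLp

theorem norm_tensorL2 [SigmaFinite ν] (ψ φ : Lp ℝ 2 ν) : ‖tensorL2 ψ φ‖ = ‖ψ‖ * ‖φ‖ := by
  have h : ‖tensorL2 ψ φ‖ ^ 2 = (‖ψ‖ * ‖φ‖) ^ 2 := by
    rw [mul_pow, norm_sq_eq_integral_sq, norm_sq_eq_integral_sq, norm_sq_eq_integral_sq,
      ← integral_prod_mul]
    refine integral_congr_ae ?_
    filter_upwards [coeFn_tensorL2 ψ φ] with p hp
    rw [hp]; ring
  exact (pow_left_inj₀ (norm_nonneg _) (by positivity) two_ne_zero).1 h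

/-- `T` is the Hilbert–Schmidt operator with kernel `k`, in weak form. -/
def HasKernel (T : Lp ℝ 2 ν →L[ℝ] Lp ℝ 2 ν) (k : Lp ℝ 2 (ν.prod ν)) : Prop :=
  ∀ φ ψ : Lp ℝ 2 ν, inner ℝ ψ (T φ) = inner ℝ (tensorL2 ψ φ) k

namespace HasKernel

variable {T T' : Lp ℝ 2 ν →L[ℝ] Lp ℝ 2 ν} {k k' : Lp ℝ 2 (ν.prod ν)}

/-- Testing with `ψ = T φ` and using Cauchy–Schwarz gives `‖T φ‖² ≤ ‖T φ‖ ‖φ‖ ‖k‖`; one factor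
cancels. -/
theorem opNorm_le [SigmaFinite ν] (h : HasKernel T k) : ‖T‖ ≤ ‖k‖ := by
  refine T.opNorm_le_bound (norm_nonneg _) fun φ => ?_
  have h1 := h φ (T φ)
  rw [real_inner_self_eq_norm_sq] at h1
  have h2 := (le_abs_self _).trans (abs_real_inner_le_norm (tensorL2 (T φ) φ) k)
  rw [← h1, norm_tensorL2] at h2
  rcases (norm_nonneg (T φ)).eq_or_lt with h0 | h0
  · rw [← h0]; positivity
  · nlinarith

theorem sub (h : HasKernel T k) (h' : HasKernel T' k') : HasKernel (T - T') (k - k') := by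
  intro φ ψ
  rw [_root_.sub_apply, inner_sub_right, inner_sub_right, h φ ψ, h' φ ψ]

theorem const_smul (c : ℝ) (h : HasKernel T k) : HasKernel (c • T) (c • k) := by
  intro φ ψ
  rw [_root_.smul_apply, real_inner_smul_right, real_inner_smul_right, h φ ψ]

theorem sum {ι : Type*} (s : Finset ι) {T : ι → Lp ℝ 2 ν →L[ℝ] Lp ℝ 2 ν}
    {k : ι → Lp ℝ 2 (ν.prod ν)} (h : ∀ i ∈ s, HasKernel (T i) (k i)) :
    HasKernel (∑ i ∈ s, T i) (∑ i ∈ s, k i) := by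
  intro φ ψ
  rw [_root_.sum_apply, inner_sum, inner_sum]
  exact Finset.sum_congr rfl fun i hi => h i hi φ ψ

theorem integral {β : Type*} [MeasurableSpace β] {ρ : Measure β}
    {T : β → Lp ℝ 2 ν →L[ℝ] Lp ℝ 2 ν} {k : β → Lp ℝ 2 (ν.prod ν)}
    (hT : Integrable T ρ) (hk : Integrable k ρ) (h : ∀ b, HasKernel (T b) (k b)) :
    HasKernel (∫ b, T b ∂ρ) (∫ b, k b ∂ρ) := by
  intro φ ψ
  rw [ContinuousLinearMap.integral_apply hT, ← integral_inner (hT.apply_continuousLinearMap φ),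
    ← integral_inner hk]
  exact integral_congr_ae (Filter.Eventually.of_forall fun b => h b φ ψ)

end HasKernel

end HilbertSchmidt

/-! ### The profile `s ↦ s * exp (-t * s)` -/

theorem abs_deriv_mul_exp_neg_le {t s : ℝ} (ht : 0 ≤ t) (hs : 0 ≤ s) :
    |Real.exp (-t * s) + s * (Real.exp (-t * s) * -t)| ≤ 1 := by
  have h1 : Real.exp (-t * s) ≤ 1 := Real.exp_le_one_iff.2 (by nlinarith [mul_nonneg ht hs])
  have h2 := Real.add_one_le_exp (t * s)
  have h3 : Real.exp (-t * s) * Real.exp (t * s) = 1 := by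
    rw [← Real.exp_add]; simp
  have h4 := Real.exp_pos (-t * s)
  have h5 := mul_nonneg ht hs
  rw [abs_le]
  constructor <;> nlinarith

/-- The derivative `(1 - t s) exp (-t s)` is at most 1 in absolute value. The Lipschitz constant is
free of `t`, so it serves all pairs `(x, y)` at once. -/
theorem abs_mul_exp_neg_sub_le {t a b : ℝ} (ht : 0 ≤ t) (ha : 0 ≤ a) (hb : 0 ≤ b) :
    |a * Real.exp (-t * a) - b * Real.exp (-t * b)| ≤ |a - b| := by
  have h := (convex_Ici (0 : ℝ)).norm_image_sub_le_of_norm_hasDerivWithin_le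
    (f := fun s => s * Real.exp (-t * s)) (C := 1)
    (f' := fun s => Real.exp (-t * s) + s * (Real.exp (-t * s) * -t))
    (fun s _ => by
      have h1 : HasDerivAt (fun s : ℝ => Real.exp (-t * s)) (Real.exp (-t * s) * -t) s := by
        simpa using ((hasDerivAt_id s).const_mul (-t)).exp
      have h2 := ((hasDerivAt_id' s).fun_mul h1).hasDerivWithinAt (s := Ici 0)
      rwa [one_mul] at h2)
    (fun s hs => abs_deriv_mul_exp_neg_le ht hs) hb ha
  simpa using h

/-! ### The transport kernel as a function of the velocity -/

namespace SlabMedium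

variable (M : SlabMedium)

/-- Here `t` is the optical depth between `x` and `y`; on the side that transport does not reach, `t
= r = 0`. Both depend on the sign of the velocity only, so `|1 / ν|` is the sole remaining variable.
-/
theorem exists_kernel_eq {μ x y : ℝ} (hμ : μ ≠ 0) (hx : x ∈ Icc M.xL M.xR)
    (hy : y ∈ Icc M.xL M.xR) (hr : |M.σr y / M.σT y| ≤ 1) :
    ∃ t r : ℝ, 0 ≤ t ∧ |r| ≤ 1 ∧ ∀ ν, 0 < μ * ν →
      M.kernel ν x y = |1 / ν| * Real.exp (-t * |1 / ν|) * r := by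
  rcases hμ.lt_or_gt with h | h
  · by_cases hxy : x ≤ y
    · refine ⟨_, _, M.integral_σT_nonneg hx.1 hxy hy.2, hr, fun ν hν => ?_⟩
      have h1 : ν < 0 := neg_of_mul_pos_right hν h.le
      simp only [kernel, h1, h1.not_gt, hxy, if_true, if_false, abs_of_neg (one_div_neg.2 h1)]
      congr 3
      ring
    · refine ⟨0, 0, le_rfl, by simp, fun ν hν => ?_⟩
      have h1 : ν < 0 := neg_of_mul_pos_right hν h.le
      simp [kernel, h1, h1.not_gt, hxy]
  · by_cases hxy : y ≤ x
    · refine ⟨_, _, M.integral_σT_nonneg hy.1 hxy hx.2, hr, fun ν hν => ?_⟩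
      have h1 : 0 < ν := pos_of_mul_pos_right hν h.le
      simp only [kernel, h1, hxy, if_true, abs_of_pos (one_div_pos.2 h1)]
      congr 3
      ring
    · refine ⟨0, 0, le_rfl, by simp, fun ν hν => ?_⟩
      have h1 : 0 < ν := pos_of_mul_pos_right hν h.le
      simp [kernel, h1, hxy]

theorem abs_kernel_sub_le {μ ν x y : ℝ} (h : 0 < μ * ν) (hx : x ∈ Icc M.xL M.xR)
    (hy : y ∈ Icc M.xL M.xR) (hr : |M.σr y / M.σT y| ≤ 1) :
    |M.kernel μ x y - M.kernel ν x y| ≤ |1 / μ - 1 / ν| := by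
  have hμ : μ ≠ 0 := left_ne_zero_of_mul h.ne'
  obtain ⟨t, r, ht, hr, hk⟩ := M.exists_kernel_eq hμ hx hy hr
  rw [hk μ (mul_self_pos.2 hμ), hk ν h, ← sub_mul, abs_mul]
  exact (mul_le_of_le_one_right (abs_nonneg _) hr).trans
    ((abs_mul_exp_neg_sub_le ht (abs_nonneg _) (abs_nonneg _)).trans (abs_abs_sub_abs_le _ _))

theorem abs_kernel_le {μ x y : ℝ} (hx : x ∈ Icc M.xL M.xR)
    (hy : y ∈ Icc M.xL M.xR) (hr : |M.σr y / M.σT y| ≤ 1) :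
    |M.kernel μ x y| ≤ |1 / μ| := by
  rcases eq_or_ne μ 0 with rfl | hμ
  · simp [kernel]
  obtain ⟨t, r, ht, hr, hk⟩ := M.exists_kernel_eq hμ hx hy hr
  rw [hk μ (mul_self_pos.2 hμ), abs_mul]
  refine (mul_le_of_le_one_right (abs_nonneg _) hr).trans ?_
  -- The Lipschitz bound compared with the value at `b = 0`, where the profile vanishes.
  simpa using abs_mul_exp_neg_sub_le ht (abs_nonneg (1 / μ)) le_rfl

theorem ae_weight_prod : ∀ᵐ p ∂(M.weight.prod M.weight),
    p.1 ∈ Icc M.xL M.xR ∧ p.2 ∈ Icc M.xL M.xR ∧ |M.σr p.2 / M.σT p.2| ≤ 1 := by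
  have hI : ∀ᵐ x ∂M.weight, x ∈ Icc M.xL M.xR :=
    M.weight_ac.ae_le (ae_restrict_mem measurableSet_Icc)
  filter_upwards [Measure.quasiMeasurePreserving_fst.ae hI,
    Measure.quasiMeasurePreserving_snd.ae hI,
    Measure.quasiMeasurePreserving_snd.ae (M.weight_ac.ae_le M.ratio_bound)] with p h1 h2 h3
  exact ⟨h1, h2, h3⟩

theorem ae_kernel_sub_bound {μ ν : ℝ} (h : 0 < μ * ν) :
    ∀ᵐ p ∂(M.weight.prod M.weight),
      ‖M.kernel μ p.1 p.2 - M.kernel ν p.1 p.2‖ ≤ |1 / μ - 1 / ν| := by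
  filter_upwards [M.ae_weight_prod] with p hp
  exact M.abs_kernel_sub_le h hp.1 hp.2.1 hp.2.2

theorem ae_kernel_bound (μ : ℝ) :
    ∀ᵐ p ∂(M.weight.prod M.weight), ‖M.kernel μ p.1 p.2‖ ≤ |1 / μ| := by
  filter_upwards [M.ae_weight_prod] with p hp
  exact M.abs_kernel_le hp.1 hp.2.1 hp.2.2

theorem memLp_kernel (μ : ℝ) :
    MemLp (fun p : ℝ × ℝ => M.kernel μ p.1 p.2) 2 (M.weight.prod M.weight) :=
  MemLp.of_bound (M.kernel_meas μ) _ (M.ae_kernel_bound μ)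

/-- The kernel `k_μ` as an element of `L²`. -/
noncomputable def kernelL2 (μ : ℝ) : Lp ℝ 2 (M.weight.prod M.weight) := (M.memLp_kernel μ).toLp

theorem coeFn_kernelL2 (μ : ℝ) :
    M.kernelL2 μ =ᵐ[M.weight.prod M.weight] fun p => M.kernel μ p.1 p.2 :=
  (M.memLp_kernel μ).coeFn_toLp

theorem exists_norm_kernelL2_sub_le : ∃ V : ℝ, 0 ≤ V ∧ ∀ μ ν : ℝ, 0 < μ * ν →
    ‖M.kernelL2 μ - M.kernelL2 ν‖ ≤ V * |1 / μ - 1 / ν| := by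
  refine ⟨_, NNReal.coe_nonneg (measureUnivNNReal (M.weight.prod M.weight) ^
    (ENNReal.toReal 2)⁻¹), fun μ ν h => ?_⟩
  refine Lp.norm_le_of_ae_bound (abs_nonneg _) ?_
  filter_upwards [M.coeFn_kernelL2 μ, M.coeFn_kernelL2 ν, M.ae_kernel_sub_bound h,
    Lp.coeFn_sub (M.kernelL2 μ) (M.kernelL2 ν)] with p h1 h2 h3 h4
  rwa [h4, Pi.sub_apply, h1, h2]

/-- This is Fubini; the integrand is integrable as a product of two `L²` functions on the product
space. -/
theorem hasKernel_transportOp (μ : ℝ) : HasKernel (M.transportOp μ) (M.kernelL2 μ) := by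
  intro φ ψ
  have h1 : Integrable (fun p : ℝ × ℝ => ψ p.1 * (M.kernel μ p.1 p.2 * φ p.2))
      (M.weight.prod M.weight) := by
    refine ((memLp_two_tensor ψ φ).integrable_mul (M.memLp_kernel μ)).congr ?_
    exact Filter.Eventually.of_forall fun p => by simp only [Pi.mul_apply]; ring
  have h2 : inner ℝ (tensorL2 ψ φ) (M.kernelL2 μ) =
      ∫ p : ℝ × ℝ, ψ p.1 * (M.kernel μ p.1 p.2 * φ p.2) ∂(M.weight.prod M.weight) := by
    rw [L2.inner_def]
    refine integral_congr_ae ?_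
    filter_upwards [coeFn_tensorL2 ψ φ, M.coeFn_kernelL2 μ] with p h3 h4
    rw [h3, h4, Real.inner_apply]
    ring
  rw [h2, integral_prod _ h1, L2.inner_def]
  refine integral_congr_ae ?_
  filter_upwards [M.transportOp_apply_ae μ φ] with x hx
  rw [hx, Real.inner_apply, ← integral_const_mul]

end SlabMedium

/-! ### Continuity and integrability in the velocity -/

theorem continuousOn_compl_zero_of_norm_sub_le {E : Type*} [NormedAddCommGroup E] {f : ℝ → E}
    {V : ℝ} (h : ∀ μ ν : ℝ, 0 < μ * ν → ‖f μ - f ν‖ ≤ V * |1 / μ - 1 / ν|) :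
    ContinuousOn f {0}ᶜ := by
  intro μ hμ
  have hμ0 : μ ≠ 0 := hμ
  refine ContinuousAt.continuousWithinAt ?_
  rw [ContinuousAt, tendsto_iff_norm_sub_tendsto_zero]
  have hpos : ∀ᶠ ν in nhds μ, 0 < ν * μ :=
    (continuous_id.mul continuous_const).continuousAt.eventually
      (lt_mem_nhds (mul_self_pos.2 hμ0))
  refine squeeze_zero' (g := fun ν => V * |1 / ν - 1 / μ|)
    (Filter.Eventually.of_forall fun _ => norm_nonneg _)
    (hpos.mono fun ν hν => h ν μ hν) ?_
  have hc : ContinuousAt (fun ν : ℝ => V * |1 / ν - 1 / μ|) μ := by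
    have : ContinuousAt (fun ν : ℝ => 1 / ν) μ := continuousAt_const.div continuousAt_id hμ0
    exact continuousAt_const.mul (this.sub continuousAt_const).abs
  simpa [ContinuousAt] using hc

theorem integrableOn_truncVelocity {E : Type*} [NormedAddCommGroup E] {f : ℝ → E} {δ : ℝ}
    (hδ : 0 < δ) (hf : ContinuousOn f {0}ᶜ) : IntegrableOn f (truncVelocity δ) := by
  have h : IntegrableOn f (Icc (-1) (-δ) ∪ Icc δ 1) := by
    refine (hf.mono ?_).integrableOn_compact (isCompact_Icc.union isCompact_Icc)
    rintro x (hx | hx) (rfl : x = 0)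
    · linarith [hx.2]
    · linarith [hx.1]
  exact h.mono_set (union_subset_union Ico_subset_Icc_self Ioc_subset_Icc_self)

theorem measureReal_truncVelocity {δ : ℝ} (hδ : 0 < δ) (hδ1 : δ < 1) :
    volume.real (truncVelocity δ) = 2 * (1 - δ) := by
  have hd : Disjoint (Ico (-1) (-δ)) (Ioc δ 1) := by
    rw [Set.disjoint_left]
    intro x h1 h2
    linarith [h1.2, h2.1]
  rw [truncVelocity, measureReal_union hd measurableSet_Ioc measure_Ico_lt_top.ne measure_Ioc_lt_top.ne, Real.volume_real_Ico_of_le (by linarith),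
    Real.volume_real_Ioc_of_le hδ1.le]
  ring

/-! ### Additivity of variance in a Hilbert space -/

theorem integral_norm_sum_sq_of_iIndepFun {ι Ω S E : Type*} [Fintype ι] [MeasurableSpace Ω]
    [MeasurableSpace S] [NormedAddCommGroup E] [InnerProductSpace ℝ E] [CompleteSpace E]
    {P : Measure Ω} [IsProbabilityMeasure P] {X : ι → Ω → S} {f : ι → S → E}
    (hX : ∀ i, AEMeasurable (X i) P) (hind : iIndepFun X P)
    (hf : ∀ i, MemLp (f i) 2 (P.map (X i))) (h0 : ∀ i, ∫ ω, f i (X i ω) ∂P = 0) :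
    ∫ ω, ‖∑ i, f i (X i ω)‖ ^ 2 ∂P = ∑ i, ∫ ω, ‖f i (X i ω)‖ ^ 2 ∂P := by
  classical
  have hfX : ∀ i, MemLp (fun ω => f i (X i ω)) 2 P := fun i => (hf i).comp_of_map (hX i)
  have hint : ∀ i j, Integrable (fun ω => inner ℝ (f i (X i ω)) (f j (X j ω))) P :=
    fun i j => ((hfX i).norm.integrable_mul (hfX j).norm).mono'
      ((hfX i).1.inner (hfX j).1)
      (Filter.Eventually.of_forall fun ω => norm_inner_le_norm _ _)
  have hprob : ∀ i, IsProbabilityMeasure (P.map (X i)) := fun i =>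
    Measure.isProbabilityMeasure_map (hX i)
  simp_rw [← real_inner_self_eq_norm_sq, sum_inner, inner_sum]
  rw [integral_finsetSum _ fun i _ => integrable_finsetSum _ fun j _ => hint i j]
  refine Finset.sum_congr rfl fun i _ => ?_
  rw [integral_finsetSum _ fun j _ => hint i j]
  refine Finset.sum_eq_single i (fun j _ hij => ?_) (by simp)
  -- By independence the mean of a cross term is the inner product of the two means, hence zero.
  have h := (hind.indepFun hij.symm).integral_bilin_comp_comp (hX i) (hX j)
    ((hf i).integrable one_le_two) ((hf j).integrable one_le_two) (innerSL ℝ)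
  rw [h0 i, map_zero, zero_apply] at h
  exact h

/-! ### Sums and integrals over a symmetric mesh -/

namespace VelocityMesh

variable {δ : ℝ} {m : ℕ} (G : VelocityMesh δ m)

theorem node_lt (ℓ : Fin m) : G.node ℓ.castSucc < G.node ℓ.succ :=
  G.strictMono ℓ.castSucc_lt_succ

theorem halfCell_subset (ℓ : Fin m) : G.halfCell ℓ ⊆ Ico (-1) (-δ) := by
  refine Ico_subset_Ico ?_ ?_
  · rw [← G.node_zero]
    exact G.strictMono.monotone (Fin.zero_le _)
  · rw [← G.node_last]
    exact G.strictMono.monotone (Fin.le_last _)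

theorem measureReal_cell_castAdd (ℓ : Fin m) :
    volume.real (G.cell (Fin.castAdd m ℓ)) = volume.real (G.halfCell ℓ) := by
  rw [cell, Fin.append_left]

theorem measureReal_halfCell (ℓ : Fin m) :
    volume.real (G.halfCell ℓ) = G.node ℓ.succ - G.node ℓ.castSucc :=
  Real.volume_real_Ico_of_le (G.node_lt ℓ).le

theorem measureReal_cell_natAdd_rev (ℓ : Fin m) :
    volume.real (G.cell (Fin.natAdd m ℓ.rev)) = volume.real (G.halfCell ℓ) := by
  rw [cell, Fin.append_right, Fin.rev_rev, Real.volume_real_Ioc_of_le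
    (neg_le_neg (G.node_lt ℓ).le), measureReal_halfCell]
  ring

/-- An ordinate and its reflection are dependent and their cells have equal weight. Grouping them
leaves one term per `u ℓ`, as the independence argument requires. -/
theorem sum_smul_symmOrdinates {E : Type*} [NormedAddCommGroup E] [NormedSpace ℝ E] (F : ℝ → E)
    (u : Fin m → ℝ) :
    ∑ ℓ, G.weight ℓ • F (symmOrdinates u ℓ) =
      ∑ ℓ : Fin m, G.weight (Fin.castAdd m ℓ) • (F (u ℓ) + F (-u ℓ)) := by
  rw [Fin.sum_univ_add, ← Equiv.sum_comp Fin.revPerm fun j => G.weight (Fin.natAdd m j) • _,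
    ← Finset.sum_add_distrib]
  refine Finset.sum_congr rfl fun ℓ _ => ?_
  simp only [symmOrdinates, Fin.append_left, Fin.append_right, Fin.revPerm_apply, Fin.rev_rev,
    weight, measureReal_cell_natAdd_rev, measureReal_cell_castAdd, smul_add]

theorem sum_integral_halfCell {E : Type*} [NormedAddCommGroup E] [NormedSpace ℝ E] {F : ℝ → E}
    (hδ1 : δ < 1) (hF : IntegrableOn F (Ico (-1) (-δ))) :
    ∑ ℓ, ∫ u in G.halfCell ℓ, F u = ∫ u in Ico (-1) (-δ), F u := by
  -- The nodes are indexed by `ℕ` to use additivity over adjacent intervals; the value 0 beyond `m`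
  -- is never used.
  set a : ℕ → ℝ := fun k => if h : k < m + 1 then G.node ⟨k, h⟩ else 0 with ha
  have h1 : ∀ ℓ : Fin m, a ℓ = G.node ℓ.castSucc := fun ℓ => by
    simp only [ha, dif_pos (ℓ.2.trans (Nat.lt_succ_self m))]; rfl
  have h2 : ∀ ℓ : Fin m, a (ℓ + 1) = G.node ℓ.succ := fun ℓ => by
    simp only [ha, dif_pos (Nat.succ_lt_succ ℓ.2)]; rfl
  have ha0 : a 0 = -1 := by
    simp only [ha, dif_pos (Nat.succ_pos m)]; exact G.node_zero
  have ham : a m = -δ := by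
    simp only [ha, dif_pos (Nat.lt_succ_self m)]; exact G.node_last
  have h3 : ∀ ℓ : Fin m, ∫ u in G.halfCell ℓ, F u = ∫ u in a ℓ..a (ℓ + 1), F u := fun ℓ => by
    rw [h1, h2, intervalIntegral.integral_of_le (G.node_lt ℓ).le, halfCell, integral_Ico_eq_integral_Ioc]
  rw [Finset.sum_congr rfl fun ℓ _ => h3 ℓ,
    Fin.sum_univ_eq_sum_range (fun k => ∫ u in a k..a (k + 1), F u),
    intervalIntegral.sum_integral_adjacent_intervals, ha0, ham,
    intervalIntegral.integral_of_le (by linarith), integral_Ico_eq_integral_Ioc]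
  intro k hk
  have h4 := h1 ⟨k, hk⟩
  have h5 := h2 ⟨k, hk⟩
  simp only at h4 h5
  rw [h4, h5, intervalIntegrable_iff_integrableOn_Ico_of_le (G.node_lt _).le]
  exact hF.mono_set (G.halfCell_subset _)

theorem integrableOn_comp_neg {E : Type*} [NormedAddCommGroup E] {F : ℝ → E}
    (hF : IntegrableOn F (truncVelocity δ)) :
    IntegrableOn (fun u => F (-u)) (Ico (-1) (-δ)) := by
  have h : IntegrableOn F (Ioc δ 1) := hF.mono_set subset_union_right
  have h' : IntegrableOn (fun u => F (-u)) (Neg.neg ⁻¹' Ioc δ 1) :=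
    ((Measure.measurePreserving_neg volume).integrableOn_comp_preimage
      (MeasurableEquiv.neg ℝ).measurableEmbedding).2 h
  convert h' using 1
  simp

theorem setIntegral_truncVelocity {E : Type*} [NormedAddCommGroup E] [NormedSpace ℝ E]
    {F : ℝ → E} (hδ : 0 < δ) (hδ1 : δ < 1) (hF : IntegrableOn F (truncVelocity δ)) :
    ∫ u in truncVelocity δ, F u = ∫ u in Ico (-1) (-δ), (F u + F (-u)) := by
  have hd : Disjoint (Ico (-1) (-δ)) (Ioc δ 1) := by
    rw [Set.disjoint_left]
    intro x h1 h2
    linarith [h1.2, h2.1]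
  rw [truncVelocity, setIntegral_union hd measurableSet_Ioc (hF.mono_set subset_union_left)
    (hF.mono_set subset_union_right), integral_add (hF.mono_set subset_union_left)
    (integrableOn_comp_neg hF)]
  congr 1
  rw [integral_Ico_eq_integral_Ioc, ← intervalIntegral.integral_of_le hδ1.le,
    ← intervalIntegral.integral_of_le (neg_le_neg hδ1.le), intervalIntegral.integral_comp_neg,
    neg_neg, neg_neg]

end VelocityMesh

/-! ### The kernel of the error operator -/

namespace SlabMedium

variable (M : SlabMedium)

theorem continuousOn_kernelL2 : ContinuousOn M.kernelL2 {0}ᶜ := by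
  obtain ⟨V, -, hV⟩ := M.exists_norm_kernelL2_sub_le
  exact continuousOn_compl_zero_of_norm_sub_le hV

theorem continuousOn_transportOp : ContinuousOn M.transportOp {0}ᶜ := by
  obtain ⟨V, -, hV⟩ := M.exists_norm_kernelL2_sub_le
  exact continuousOn_compl_zero_of_norm_sub_le fun μ ν h =>
    ((M.hasKernel_transportOp μ).sub (M.hasKernel_transportOp ν)).opNorm_le.trans (hV μ ν h)

/-- The sum of the kernels for the opposite velocities `μ` and `-μ`. -/
noncomputable def kernelPair (μ : ℝ) : Lp ℝ 2 (M.weight.prod M.weight) :=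
  M.kernelL2 μ + M.kernelL2 (-μ)

theorem integrableOn_kernelPair {δ : ℝ} (hδ : 0 < δ) :
    IntegrableOn M.kernelPair (Ico (-1) (-δ)) := by
  have h := integrableOn_truncVelocity hδ M.continuousOn_kernelL2
  exact (h.mono_set subset_union_left).add (VelocityMesh.integrableOn_comp_neg h)

/-- Since `|u|, |v| > δ`, one has `|1/u - 1/v| ≤ |u - v| / δ²`; the factor 2 counts the two opposite
velocities. -/
theorem exists_norm_kernelPair_sub_le {δ : ℝ} (hδ : 0 < δ) :
    ∃ D : ℝ, 0 ≤ D ∧ ∀ u ∈ Ico (-1) (-δ), ∀ v ∈ Ico (-1) (-δ),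
      ‖M.kernelPair u - M.kernelPair v‖ ≤ D * |u - v| := by
  obtain ⟨V, hV0, hV⟩ := M.exists_norm_kernelL2_sub_le
  refine ⟨2 * V / δ ^ 2, by positivity, fun u hu v hv => ?_⟩
  have hu0 : δ < -u := by linarith [hu.2]
  have hv0 : δ < -v := by linarith [hv.2]
  have huv : δ ^ 2 ≤ u * v := by nlinarith
  have hpos : 0 < u * v := (by positivity : 0 < δ ^ 2).trans_le huv
  have h1 : |1 / u - 1 / v| ≤ |u - v| / δ ^ 2 := by
    have hu' : u ≠ 0 := left_ne_zero_of_mul hpos.ne'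
    have hv' : v ≠ 0 := right_ne_zero_of_mul hpos.ne'
    have e : 1 / u - 1 / v = -(u - v) / (u * v) := by field_simp; ring
    rw [e, abs_div, abs_neg, abs_of_pos hpos]
    gcongr
  have h2 : |1 / -u - 1 / -v| = |1 / u - 1 / v| := by
    rw [one_div_neg_eq_neg_one_div, one_div_neg_eq_neg_one_div, neg_sub_neg, abs_sub_comm]
  have h3 := hV u v hpos
  have h4 := hV (-u) (-v) (by linarith [neg_mul_neg u v])
  rw [h2] at h4
  calc ‖M.kernelPair u - M.kernelPair v‖
      = ‖(M.kernelL2 u - M.kernelL2 v) + (M.kernelL2 (-u) - M.kernelL2 (-v))‖ := by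
        rw [kernelPair, kernelPair]; congr 1; abel
    _ ≤ V * |1 / u - 1 / v| + V * |1 / u - 1 / v| := (norm_add_le _ _).trans (add_le_add h3 h4)
    _ ≤ V * (|u - v| / δ ^ 2) + V * (|u - v| / δ ^ 2) := by gcongr
    _ = 2 * V / δ ^ 2 * |u - v| := by ring

variable {δ : ℝ} {m : ℕ} (G : VelocityMesh δ m)

/-- The contribution of the cell `ℓ` and its reflection to the kernel of `𝒯^ξ - 𝒯`. -/
noncomputable def cellError (ℓ : Fin m) (u : ℝ) : Lp ℝ 2 (M.weight.prod M.weight) :=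
  G.weight (Fin.castAdd m ℓ) • (M.kernelPair u - ⨍ v in G.halfCell ℓ, M.kernelPair v)

theorem hasKernel_romOp_sub_iterOp (hδ : 0 < δ) (hδ1 : δ < 1) (u : Fin m → ℝ) :
    HasKernel (M.romOp G u - M.iterOp δ) (∑ ℓ, M.cellError G ℓ (u ℓ)) := by
  -- An empty mesh would have a single node, forcing `δ = 1`.
  have hm : ((m + m : ℕ) : ℝ) ≠ 0 := by
    have : m ≠ 0 := by
      rintro rfl
      have h := G.node_zero.symm.trans G.node_last
      linarith
    exact_mod_cast (by omega : m + m ≠ 0)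
  have h1 : HasKernel (M.romOp G u)
      (∑ ℓ, G.weight (Fin.castAdd m ℓ) • M.kernelPair (u ℓ)) := by
    have h := (HasKernel.sum Finset.univ fun ℓ _ =>
      (M.hasKernel_transportOp (symmOrdinates u ℓ)).const_smul
        (G.rescaledWeight ℓ)).const_smul (1 / ((m + m : ℕ) : ℝ))
    refine Eq.mp (congrArg (HasKernel (M.romOp G u)) ?_) h
    change _ = ∑ ℓ, G.weight (Fin.castAdd m ℓ) • (M.kernelL2 (u ℓ) + M.kernelL2 (-u ℓ))
    rw [Finset.smul_sum, ← G.sum_smul_symmOrdinates M.kernelL2 u]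
    refine Finset.sum_congr rfl fun ℓ _ => ?_
    rw [smul_smul, VelocityMesh.rescaledWeight, one_div, inv_mul_cancel_left₀ hm]
  have hK := integrableOn_truncVelocity hδ M.continuousOn_kernelL2
  have hP := M.integrableOn_kernelPair hδ
  have h2 : HasKernel (M.iterOp δ)
      (∑ ℓ, G.weight (Fin.castAdd m ℓ) • ⨍ v in G.halfCell ℓ, M.kernelPair v) := by
    have h := (HasKernel.integral (integrableOn_truncVelocity hδ M.continuousOn_transportOp) hK
      M.hasKernel_transportOp).const_smul (volume.real (truncVelocity δ))⁻¹
    rw [iterOp, setAverage_eq]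
    convert h using 1
    rw [VelocityMesh.setIntegral_truncVelocity hδ hδ1 hK]
    change _ = _ • ∫ v in Ico (-1) (-δ), M.kernelPair v
    rw [← G.sum_integral_halfCell hδ1 hP, Finset.smul_sum]
    refine Finset.sum_congr rfl fun ℓ _ => ?_
    have hc : volume.real (G.halfCell ℓ) ≠ 0 := by
      rw [G.measureReal_halfCell]
      exact (sub_pos.2 (G.node_lt ℓ)).ne'
    -- The cell width cancels: weight times cell average is the cell integral divided by `|S|`.
    rw [setAverage_eq, smul_smul, VelocityMesh.weight, G.measureReal_cell_castAdd]
    congr 1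
    field_simp
  convert h1.sub h2 using 1
  rw [← Finset.sum_sub_distrib]
  exact Finset.sum_congr rfl fun ℓ _ => smul_sub _ _ _

/-- On the cell, `kernelPair` stays in a closed ball about its value at `u`, of radius `D` times the
width. The ball is convex and closed, so it also contains the average. -/
theorem norm_cellError_le (hδ : 0 < δ) {D : ℝ} (hD0 : 0 ≤ D)
    (hD : ∀ u ∈ Ico (-1) (-δ), ∀ v ∈ Ico (-1) (-δ),
      ‖M.kernelPair u - M.kernelPair v‖ ≤ D * |u - v|) (ℓ : Fin m) {u : ℝ}
    (hu : u ∈ G.halfCell ℓ) :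
    ‖M.cellError G ℓ u‖ ≤
      G.weight (Fin.castAdd m ℓ) * (D * volume.real (G.halfCell ℓ)) := by
  have hω : 0 ≤ G.weight (Fin.castAdd m ℓ) := div_nonneg measureReal_nonneg measureReal_nonneg
  have hint : IntegrableOn M.kernelPair (G.halfCell ℓ) :=
    (M.integrableOn_kernelPair hδ).mono_set (G.halfCell_subset ℓ)
  have hvol : volume (G.halfCell ℓ) ≠ 0 := by
    simpa [VelocityMesh.halfCell] using G.node_lt ℓ
  have hmem := (convex_closedBall (M.kernelPair u)
    (D * volume.real (G.halfCell ℓ))).set_average_mem Metric.isClosed_closedBall hvol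
    measure_Ico_lt_top.ne (f := M.kernelPair) ?_ hint
  · rw [mem_closedBall_iff_norm'] at hmem
    rw [cellError, norm_smul, Real.norm_of_nonneg hω]
    gcongr
  · filter_upwards [ae_restrict_mem measurableSet_Ico] with v hv
    rw [mem_closedBall_iff_norm']
    refine (hD u (G.halfCell_subset ℓ hu) v (G.halfCell_subset ℓ hv)).trans ?_
    rw [G.measureReal_halfCell]
    gcongr
    rw [abs_le]
    constructor <;> linarith [hu.1, hu.2, hv.1, hv.2]

end SlabMedium

/-! ### The random error: mean, measurability, second moment -/

namespace IsRandomOrdinates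

variable {δ : ℝ} {m : ℕ} {G : VelocityMesh δ m} {Ω : Type*} [MeasurableSpace Ω] {P : Measure Ω}
  {X : Fin m → Ω → ℝ} (h : IsRandomOrdinates G P X)

include h

theorem map_eq (ℓ : Fin m) :
    P.map (X ℓ) = (volume (G.halfCell ℓ))⁻¹ • volume.restrict (G.halfCell ℓ) :=
  h.uniform ℓ

theorem ae_map_mem (ℓ : Fin m) : ∀ᵐ u ∂(P.map (X ℓ)), u ∈ G.halfCell ℓ := by
  rw [h.map_eq]
  exact Measure.ae_smul_measure (ae_restrict_mem measurableSet_Ico) _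

theorem integrable_map {E : Type*} [NormedAddCommGroup E] {f : ℝ → E} (ℓ : Fin m)
    (hf : IntegrableOn f (G.halfCell ℓ)) : Integrable f (P.map (X ℓ)) := by
  rw [h.map_eq]
  refine Integrable.smul_measure hf (ENNReal.inv_ne_top.2 ?_)
  simpa [VelocityMesh.halfCell] using G.node_lt ℓ

theorem integral_map_eq {E : Type*} [NormedAddCommGroup E] [NormedSpace ℝ E] {f : ℝ → E}
    (ℓ : Fin m) : ∫ u, f u ∂(P.map (X ℓ)) = ⨍ u in G.halfCell ℓ, f u := by
  rw [h.map_eq, average, Measure.restrict_apply_univ]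

theorem integral_cellError [IsProbabilityMeasure P] (M : SlabMedium) (hδ : 0 < δ) (ℓ : Fin m) :
    ∫ ω, M.cellError G ℓ (X ℓ ω) ∂P = 0 := by
  have hint : IntegrableOn M.kernelPair (G.halfCell ℓ) :=
    (M.integrableOn_kernelPair hδ).mono_set (G.halfCell_subset ℓ)
  have hint' := h.integrable_map ℓ hint
  have := Measure.isProbabilityMeasure_map (μ := P) (h.measurable ℓ).aemeasurable
  have hm : AEStronglyMeasurable (M.cellError G ℓ) (P.map (X ℓ)) :=
    (hint'.1.sub aestronglyMeasurable_const).const_smul (G.weight (Fin.castAdd m ℓ))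
  rw [← integral_map (h.measurable ℓ).aemeasurable hm]
  unfold SlabMedium.cellError
  rw [integral_smul, integral_sub hint' (integrable_const _), h.integral_map_eq]
  simp

theorem memLp_cellError [IsProbabilityMeasure P] (M : SlabMedium) (hδ : 0 < δ) (ℓ : Fin m) :
    MemLp (M.cellError G ℓ) 2 (P.map (X ℓ)) := by
  obtain ⟨D, hD0, hD⟩ := M.exists_norm_kernelPair_sub_le hδ
  have := Measure.isProbabilityMeasure_map (μ := P) (h.measurable ℓ).aemeasurable
  have hint' := h.integrable_map ℓ
    ((M.integrableOn_kernelPair hδ).mono_set (G.halfCell_subset ℓ))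
  refine MemLp.of_bound
    ((hint'.1.sub aestronglyMeasurable_const).const_smul (G.weight (Fin.castAdd m ℓ)))
    (G.weight (Fin.castAdd m ℓ) * (D * volume.real (G.halfCell ℓ))) ?_
  filter_upwards [h.ae_map_mem ℓ] with u hu
  exact M.norm_cellError_le G hδ hD0 hD ℓ hu

/-- The Hilbert–Schmidt bound dominates the operator norm but says nothing about its measurability,
which comes from continuity of `μ ↦ 𝒜_μ` away from 0. -/
theorem aestronglyMeasurable_romOp (M : SlabMedium) (hδ : 0 < δ) :
    AEStronglyMeasurable (fun ω => M.romOp G (fun ℓ => X ℓ ω)) P := by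
  have hT := integrableOn_truncVelocity hδ M.continuousOn_transportOp
  have h1 : ∀ ℓ, AEStronglyMeasurable (fun ω => M.transportOp (X ℓ ω)) P := fun ℓ =>
    (h.integrable_map ℓ (hT.mono_set
      ((G.halfCell_subset ℓ).trans subset_union_left))).1.comp_measurable (h.measurable ℓ)
  have h2 : ∀ ℓ, AEStronglyMeasurable (fun ω => M.transportOp (-X ℓ ω)) P := fun ℓ =>
    (h.integrable_map ℓ ((VelocityMesh.integrableOn_comp_neg hT).mono_set
      (G.halfCell_subset ℓ))).1.comp_measurable (h.measurable ℓ)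
  unfold SlabMedium.romOp
  refine AEStronglyMeasurable.const_smul (f := fun ω => ∑ ℓ : Fin (m + m),
    G.rescaledWeight ℓ • M.transportOp (symmOrdinates (fun ℓ => X ℓ ω) ℓ)) ?_ (1 / ((m + m : ℕ) : ℝ))
  refine Finset.aestronglyMeasurable_fun_sum _ fun ℓ _ => ?_
  refine AEStronglyMeasurable.const_smul
    (f := fun ω => M.transportOp (symmOrdinates (fun ℓ => X ℓ ω) ℓ)) ?_ (G.rescaledWeight ℓ)
  induction ℓ using Fin.addCases with
  | left ℓ => simpa only [symmOrdinates, Fin.append_left] using h1 ℓ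
  | right ℓ => simpa only [symmOrdinates, Fin.append_right] using h2 ℓ.rev

theorem integrable_norm_romOp_sub_iterOp_sq [IsProbabilityMeasure P] (M : SlabMedium)
    (hδ : 0 < δ) (hδ1 : δ < 1) :
    Integrable (fun ω => ‖M.romOp G (fun ℓ => X ℓ ω) - M.iterOp δ‖ ^ 2) P := by
  have hL : MemLp (fun ω => ∑ ℓ, M.cellError G ℓ (X ℓ ω)) 2 P :=
    memLp_finsetSum _ fun ℓ _ =>
      (h.memLp_cellError M hδ ℓ).comp_of_map (h.measurable ℓ).aemeasurable
  have hR : MemLp (fun ω => M.romOp G (fun ℓ => X ℓ ω) - M.iterOp δ) 2 P :=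
    hL.of_le ((h.aestronglyMeasurable_romOp M hδ).sub aestronglyMeasurable_const)
      (Filter.Eventually.of_forall fun ω => (M.hasKernel_romOp_sub_iterOp G hδ hδ1 _).opNorm_le)
  exact hR.integrable_norm_pow two_ne_zero

theorem integral_norm_romOp_sub_iterOp_sq_le [IsProbabilityMeasure P] (M : SlabMedium)
    (hδ : 0 < δ) (hδ1 : δ < 1) {b : ℝ}
    (hb : ∀ ℓ, ∀ u ∈ G.halfCell ℓ, ‖M.cellError G ℓ u‖ ≤ b) :
    ∫ ω, ‖M.romOp G (fun ℓ => X ℓ ω) - M.iterOp δ‖ ^ 2 ∂P ≤ m * b ^ 2 := by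
  have hX : ∀ ℓ, AEMeasurable (X ℓ) P := fun ℓ => (h.measurable ℓ).aemeasurable
  have hE : ∀ ℓ, MemLp (fun ω => M.cellError G ℓ (X ℓ ω)) 2 P := fun ℓ =>
    (h.memLp_cellError M hδ ℓ).comp_of_map (hX ℓ)
  have hL : MemLp (fun ω => ∑ ℓ, M.cellError G ℓ (X ℓ ω)) 2 P :=
    memLp_finsetSum _ fun ℓ _ => hE ℓ
  calc ∫ ω, ‖M.romOp G (fun ℓ => X ℓ ω) - M.iterOp δ‖ ^ 2 ∂P
      ≤ ∫ ω, ‖∑ ℓ, M.cellError G ℓ (X ℓ ω)‖ ^ 2 ∂P := by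
        refine integral_mono (h.integrable_norm_romOp_sub_iterOp_sq M hδ hδ1)
          (hL.integrable_norm_pow two_ne_zero) fun ω => ?_
        exact pow_le_pow_left₀ (norm_nonneg _)
          (M.hasKernel_romOp_sub_iterOp G hδ hδ1 _).opNorm_le 2
    _ = ∑ ℓ, ∫ ω, ‖M.cellError G ℓ (X ℓ ω)‖ ^ 2 ∂P :=
        integral_norm_sum_sq_of_iIndepFun hX h.indep (h.memLp_cellError M hδ)
          (h.integral_cellError M hδ)
    _ ≤ ∑ _ℓ : Fin m, b ^ 2 := by
        refine Finset.sum_le_sum fun ℓ _ => ?_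
        have h1 : ∀ᵐ ω ∂P, ‖M.cellError G ℓ (X ℓ ω)‖ ^ 2 ≤ b ^ 2 := by
          filter_upwards [ae_of_ae_map (hX ℓ) (h.ae_map_mem ℓ)] with ω hω
          exact pow_le_pow_left₀ (norm_nonneg _) (hb ℓ _ hω) 2
        simpa using integral_mono_ae ((hE ℓ).integrable_norm_pow two_ne_zero)
          (integrable_const (b ^ 2)) h1
    _ = m * b ^ 2 := by simp

end IsRandomOrdinates

/-! ### The rate of convergence -/

theorem mainTheorem3 (M : SlabMedium) (δ : ℝ) (hδ : 0 < δ) (hδ1 : δ < 1) :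
    IntegrableOn M.transportOp (truncVelocity δ) ∧
    ∀ K : ℝ, ∃ C : ℝ, ∀ (m n : ℕ), n = m + m → ∀ (G : VelocityMesh δ m),
      (∀ ℓ, G.rescaledWeight ℓ ≤ K) →
      ∀ (Ω : Type*) [MeasurableSpace Ω] (P : Measure Ω) [IsProbabilityMeasure P]
        (X : Fin m → Ω → ℝ), IsRandomOrdinates G P X →
        Integrable (fun ω => ‖M.romOp G (fun ℓ => X ℓ ω) - M.iterOp δ‖ ^ 2) P ∧
        ∫ ω, ‖M.romOp G (fun ℓ => X ℓ ω) - M.iterOp δ‖ ^ 2 ∂P ≤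
          C * (Real.log n + 1) / (n : ℝ) ^ 3 := by
  refine ⟨integrableOn_truncVelocity hδ M.continuousOn_transportOp, fun K => ?_⟩
  obtain ⟨D, hD0, hD⟩ := M.exists_norm_kernelPair_sub_le hδ
  -- A cell of weight `w ≤ K / n` has width `2 (1 - δ) w ≤ 2 K / n`, so its error is at most `w * D
  -- * (2 K / n) ≤ 2 D K² / n²`. The constant is the square of this numerator.
  refine ⟨(2 * D * K ^ 2) ^ 2, fun m n hn G hK Ω _ P _ X hX =>
    ⟨hX.integrable_norm_romOp_sub_iterOp_sq M hδ hδ1, ?_⟩⟩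
  have hm0 : m ≠ 0 := by
    rintro rfl
    have h := G.node_zero.symm.trans G.node_last
    linarith
  have hn1 : (1 : ℝ) ≤ n := by exact_mod_cast (by omega : 1 ≤ n)
  have hn0 : (0 : ℝ) < n := by linarith
  have hS := measureReal_truncVelocity hδ hδ1
  have hb : ∀ ℓ, ∀ u ∈ G.halfCell ℓ, ‖M.cellError G ℓ u‖ ≤ 2 * D * K ^ 2 / (n : ℝ) ^ 2 := by
    intro ℓ u hu
    refine (M.norm_cellError_le G hδ hD0 hD ℓ hu).trans ?_
    set w := G.weight (Fin.castAdd m ℓ) with hw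
    have hw0 : 0 ≤ w := div_nonneg measureReal_nonneg measureReal_nonneg
    have hwK : (n : ℝ) * w ≤ K := by
      rw [hn]
      exact hK (Fin.castAdd m ℓ)
    have hh : volume.real (G.halfCell ℓ) = w * (2 * (1 - δ)) := by
      rw [hw, VelocityMesh.weight, G.measureReal_cell_castAdd, hS, div_mul_cancel₀]
      linarith
    have hsq : ((n : ℝ) * w) ^ 2 ≤ K ^ 2 := pow_le_pow_left₀ (by positivity) hwK 2
    rw [hh, le_div_iff₀ (by positivity)]
    calc w * (D * (w * (2 * (1 - δ)))) * (n : ℝ) ^ 2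
        = 2 * D * (n * w) ^ 2 * (1 - δ) := by ring
      _ ≤ 2 * D * (n * w) ^ 2 * 1 := by gcongr; linarith
      _ ≤ 2 * D * K ^ 2 := by rw [mul_one]; gcongr
  refine (hX.integral_norm_romOp_sub_iterOp_sq_le M hδ hδ1 hb).trans ?_
  have hmn : (m : ℝ) ≤ n := by exact_mod_cast (by omega : m ≤ n)
  have hlog := Real.log_nonneg hn1
  calc (m : ℝ) * (2 * D * K ^ 2 / (n : ℝ) ^ 2) ^ 2
      ≤ n * (2 * D * K ^ 2 / (n : ℝ) ^ 2) ^ 2 := by gcongr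
    _ = (2 * D * K ^ 2) ^ 2 * 1 / (n : ℝ) ^ 3 := by field_simp
    -- The logarithm enters only here, through `1 ≤ log n + 1`.
    _ ≤ (2 * D * K ^ 2) ^ 2 * (Real.log n + 1) / (n : ℝ) ^ 3 := by gcongr; linarith
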